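/- Let $n\ge 0$ and let $D=(D_1,\dots,D_n)$ be a diagram, i.e. a list of $n$ subsets $D_j\subseteq[n]=\{1,\dots,n\}$. For $R,S\subseteq[n]$ write $R\le S$ if $\#R=\#S$ and, for each $k$, the $k$-th least element of $R$ is at most the $k$-th least element of $S$. Let $Y$ be the $n\times n$ upper-triangular matrix with indeterminates $y_{ij}$ in the positions $i\le j$ and zeros elsewhere, and for $R,S\subseteq[n]$ let $Y_R^S$ be its submatrix with rows $S$ and columns $R$. The group $B\subset GL(n,\mathbb C)$ of invertible upper-triangular matrices acts on $\mathbb C[Y]=\mathbb C[y_{ij}: i\le j]$ by $g\cdot f(Y)=f(g^{-1}Y)$; the flagged Weyl module of $D$ is the $B$-module $$M_D=\mathrm{Span}_{\mathbb C}\Bigl\{\prod_{j=1}^n\det\bigl(Y_{D_j}^{C_j}\bigr): C_j\le D_j\text{ for all }j\Bigr\}\subseteq\mathbb C[Y],$$ and its dual character is $\chi_D(x_1,\dots,x_n)=\mathrm{tr}\bigl(\mathrm{diag}(x_1,\dots,x_n): M_D^*\to M_D^*\bigr)$ for $x_1,\dots,x_n\in\mathbb C^\times$. For $S\subseteq[n]$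 let $SM_n(S)$ be the Schubert matroid on $[n]$, whose bases are the sets $R\le S$. For a matroid $M$ on $[n]$ with rank function $r_M$ let $$P(M)=\Bigl\{t\in\mathbb R^n:\ \sum_{i\in I}t_i\le r_M(I)\text{ for all } I\subsetneq[n],\ \sum_{i=1}^n t_i=r_M([n])\Bigr\}$$ be its matroid polytope. The Newton polytope $\mathrm{Newton}(f)\subseteq\mathbb R^n$ of a polynomial $f$ is the convex hull of its support, the set of exponent vectors of the monomials with nonzero coefficient in $f$. A generalized permutahedron is a polytope obtained from the standard permutahedron (whose vertices are the permutations of $(0,1,\dots,n-1)$) by moving its vertices so that all edge directions and orientations are preserved, where edges may degenerate to points. Theorem. The dual character $\chi_D$ is given by a unique polynomial in $x_1,\dots,x_n$. It has saturated Newton polytope (SNP): every lattice point of $\mathrm{Newton}(\chi_D)$ lies in the support of $\chi_D$; moreover all nonzero coefficients of $\chi_D$ are positive integers. Its Newton polytope is the Minkowski sum $$\mathrm{Newton}(\chi_D)=\sum_{j=1}^n P(SM_n(D_j)).$$ In particular, $\mathrm{Newton}(\chi_D)$ is a generalized permutahedron. -/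

import Mathlib

open scoped Pointwise

noncomputable section

namespace FlaggedWeyl

variable {n : ℕ}

/-! ### The componentwise order on subsets of `[n]` and Schubert matroids -/

/-- `R ≤ S`: the sets have the same size and, for each `k`, the `k`-th least element of `R`
does not exceed the `k`-th least element of `S`. -/
def GaleLE (R S : Finset (Fin n)) : Prop :=
  ∃ h : R.card = S.card, ∀ k : Fin S.card, R.orderEmbOfFin h k ≤ S.orderEmbOfFin rfl k

theorem card_filter_le_eq (R : Finset (Fin n)) {r : ℕ} (h : R.card = r) (m : Fin n) :
    (R.filter (· ≤ m)).card =
      (Finset.univ.filter fun k : Fin r => R.orderEmbOfFin h k ≤ m).card := by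
  rw [← Finset.card_map (R.orderEmbOfFin h).toEmbedding]
  congr 1
  ext x
  simp only [Finset.mem_filter, Finset.mem_map, Finset.mem_univ, true_and,
    RelEmbedding.coe_toEmbedding]
  constructor
  · rintro ⟨hx, hm⟩
    have : x ∈ Set.range (R.orderEmbOfFin h) := by
      rw [Finset.range_orderEmbOfFin]; exact hx
    obtain ⟨k, rfl⟩ := this
    exact ⟨k, hm, rfl⟩
  · rintro ⟨k, hk, rfl⟩
    exact ⟨Finset.orderEmbOfFin_mem R h k, hk⟩

theorem galeLE_iff (R S : Finset (Fin n)) :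
    GaleLE R S ↔ R.card = S.card ∧
      ∀ m : Fin n, (S.filter (· ≤ m)).card ≤ (R.filter (· ≤ m)).card := by
  constructor
  · rintro ⟨h, hk⟩
    refine ⟨h, fun m => ?_⟩
    rw [card_filter_le_eq R h, card_filter_le_eq S rfl]
    apply Finset.card_le_card
    intro k
    simp only [Finset.mem_filter, Finset.mem_univ, true_and]
    exact fun hm => (hk k).trans hm
  · rintro ⟨h, hm⟩
    refine ⟨h, fun k => ?_⟩
    by_contra hlt
    rw [not_le] at hlt
    have h1 := hm (S.orderEmbOfFin rfl k)
    rw [card_filter_le_eq R h, card_filter_le_eq S rfl] at h1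
    have h2 : (Finset.Iic k).card ≤ (Finset.univ.filter fun i : Fin S.card =>
        S.orderEmbOfFin rfl i ≤ S.orderEmbOfFin rfl k).card := by
      apply Finset.card_le_card
      intro i
      simp
    have h3 : (Finset.univ.filter fun i : Fin S.card =>
        R.orderEmbOfFin h i ≤ S.orderEmbOfFin rfl k).card ≤ (Finset.Iio k).card := by
      apply Finset.card_le_card
      intro i
      simp only [Finset.mem_filter, Finset.mem_univ, true_and, Finset.mem_Iio]
      intro hi
      exact (R.orderEmbOfFin h).lt_iff_lt.1 (hi.trans_lt hlt)
    rw [Fin.card_Iic] at h2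
    rw [Fin.card_Iio] at h3
    omega

theorem galeLE_refl (S : Finset (Fin n)) : GaleLE S S :=
  ⟨rfl, fun _ => le_rfl⟩

theorem galeLE_exchange (S A B : Finset (Fin n)) (hA : GaleLE A S) (hB : GaleLE B S)
    (a : Fin n) (ha : a ∈ A) (haB : a ∉ B) :
    ∃ b ∈ B, b ∉ A ∧ GaleLE (insert b (A.erase a)) S := by
  rw [galeLE_iff] at hA hB
  obtain ⟨hAc, hA⟩ := hA
  obtain ⟨hBc, hB⟩ := hB
  have hne : (B \ A).Nonempty := by
    rw [Finset.sdiff_nonempty]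
    intro hsub
    exact haB (Finset.eq_of_subset_of_card_le hsub (by omega) ▸ ha)
  set b := (B \ A).min' hne with hb
  have hbm : b ∈ B \ A := Finset.min'_mem _ _
  rw [Finset.mem_sdiff] at hbm
  have hmin : ∀ c ∈ B, c ∉ A → b ≤ c := fun c hc hcA =>
    Finset.min'_le _ _ (Finset.mem_sdiff.2 ⟨hc, hcA⟩)
  have hbe : b ∉ A.erase a := fun h => hbm.2 (Finset.mem_of_mem_erase h)
  refine ⟨b, hbm.1, hbm.2, ?_⟩
  rw [galeLE_iff]
  refine ⟨?_, fun m => ?_⟩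
  · rw [Finset.card_insert_of_notMem hbe, Finset.card_erase_add_one ha, hAc]
  · rw [Finset.filter_insert, Finset.filter_erase]
    by_cases hbmle : b ≤ m
    · rw [if_pos hbmle, Finset.card_insert_of_notMem (fun h => hbm.2
        (Finset.mem_filter.1 (Finset.mem_of_mem_erase h)).1)]
      have := Finset.pred_card_le_card_erase (s := A.filter (· ≤ m)) (a := a)
      have := hA m
      omega
    · rw [if_neg hbmle]
      refine (hB m).trans (Finset.card_le_card fun c hc => ?_)
      rw [Finset.mem_filter] at hc
      rw [Finset.mem_erase, Finset.mem_filter]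
      refine ⟨fun h => haB (h ▸ hc.1), ?_, hc.2⟩
      by_contra hcA
      exact hbmle ((hmin c hc.1 hcA).trans hc.2)

/-- The Schubert matroid `SM_n(S)` on the ground set `[n]`: its bases are the sets `R ≤ S`. -/
def schubertMatroid (S : Finset (Fin n)) : Matroid (Fin n) :=
  Matroid.ofIsBaseOfFinite (E := Set.univ) Set.finite_univ
    (fun B => ∃ R : Finset (Fin n), (R : Set (Fin n)) = B ∧ GaleLE R S)
    ⟨S, S, rfl, galeLE_refl S⟩
    (by
      rintro _ _ ⟨A, rfl, hA⟩ ⟨B, rfl, hB⟩ a ⟨ha, haB⟩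
      obtain ⟨b, hb, hbA, h⟩ := galeLE_exchange S A B hA hB a (by simpa using ha)
        (by simpa using haB)
      exact ⟨b, ⟨by simpa using hb, by simpa using hbA⟩, insert b (A.erase a), by simp, h⟩)
    (fun _ _ => Set.subset_univ _)

/-- The matroid polytope `P(M)` of a matroid `M` on `[n]` with rank function `r`:
all `t ∈ ℝⁿ` with `∑_{i ∈ I} t_i ≤ r(I)` for `I ≠ [n]` and `∑_i t_i = r([n])`. -/
def matroidPolytope (M : Matroid (Fin n)) : Set (Fin n → ℝ) :=
  {t | (∀ I : Finset (Fin n), I ≠ Finset.univ → ∑ i ∈ I, t i ≤ ((M.eRk I).toNat : ℝ)) ∧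
    ∑ i, t i = ((M.eRk Set.univ).toNat : ℝ)}

/-! ### Newton polytopes and generalized permutahedra -/

/-- The support of a polynomial, as a set of points of `ℝⁿ`. -/
def supportPoints (f : MvPolynomial (Fin n) ℂ) : Set (Fin n → ℝ) :=
  {p | ∃ m ∈ f.support, p = fun i => (m i : ℝ)}

/-- The Newton polytope: the convex hull of the support. -/
def newtonPolytope (f : MvPolynomial (Fin n) ℂ) : Set (Fin n → ℝ) :=
  convexHull ℝ (supportPoints f)

/-- Saturated Newton polytope: every lattice point of the Newton polytope is in the support. -/
def HasSNP (f : MvPolynomial (Fin n) ℂ) : Prop :=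
  ∀ p : Fin n → ℤ, (fun i => (p i : ℝ)) ∈ newtonPolytope f →
    (fun i => (p i : ℝ)) ∈ supportPoints f

/-- The vertex `(π(1), …, π(n))` (entries `0, …, n - 1`) of the standard permutahedron. -/
def permVertex (π : Equiv.Perm (Fin n)) : Fin n → ℝ :=
  fun i => ((π i : ℕ) : ℝ)

/-- A generalized permutahedron: a polytope obtained from the standard permutahedron by moving
its vertices so that all edge directions and orientations are preserved, where edges may
degenerate to points. The edges of the standard permutahedron join the vertices of `π` and
`(k l) ∘ π` for consecutive values `k`, `l = k + 1`. -/
def IsGeneralizedPermutahedron (P : Set (Fin n → ℝ)) : Prop :=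
  ∃ v : Equiv.Perm (Fin n) → (Fin n → ℝ),
    P = convexHull ℝ (Set.range v) ∧
    ∀ (π : Equiv.Perm (Fin n)) (k l : Fin n), (l : ℕ) = (k : ℕ) + 1 →
      ∃ c : ℝ, 0 ≤ c ∧
        v (Equiv.swap k l * π) - v π = c • (permVertex (Equiv.swap k l * π) - permVertex π)

/-! ### The Borel subgroup, its representations and their characters -/

/-- The subgroup `B` of upper-triangular matrices in `GL(n, ℂ)`. -/
def borel (n : ℕ) : Subgroup (GL (Fin n) ℂ) where
  carrier := {g | ∀ i j : Fin n, j < i → (g : Matrix (Fin n) (Fin n) ℂ) i j = 0}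
  one_mem' := fun i j h => by simp [h.ne']
  mul_mem' := by
    intro a b ha hb
    have : ((a : Matrix (Fin n) (Fin n) ℂ) * b).BlockTriangular id :=
      Matrix.BlockTriangular.mul (fun i j h => ha i j h) (fun i j h => hb i j h)
    exact fun i j h => by simpa using this h
  inv_mem' := by
    intro a ha
    have : ((a : Matrix (Fin n) (Fin n) ℂ)⁻¹).BlockTriangular id := by
      have : Invertible (a : Matrix (Fin n) (Fin n) ℂ) := a.invertible
      exact Matrix.blockTriangular_inv_of_blockTriangular (fun i j h => ha i j h)
    exact fun i j h => by simpa using this h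

/-- The diagonal matrix `diag(x_1, …, x_n)` as an element of `B`. -/
def torus (x : Fin n → ℂˣ) : borel n :=
  ⟨⟨Matrix.diagonal fun i => (x i : ℂ), Matrix.diagonal fun i => ((x i)⁻¹ : ℂˣ),
    by simp [Matrix.diagonal_mul_diagonal], by simp [Matrix.diagonal_mul_diagonal]⟩,
    fun i j h => by simp [h.ne']⟩

/-- The character of a `B`-module: the trace of `diag(x_1, …, x_n)`. -/
def character {N : Type*} [AddCommGroup N] [Module ℂ N] (ρ : Representation ℂ (borel n) N)
    (x : Fin n → ℂˣ) : ℂ :=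
  LinearMap.trace ℂ N (ρ (torus x))

/-- The dual character of a `B`-module: the character of the dual module. -/
def dualCharacter {N : Type*} [AddCommGroup N] [Module ℂ N] (ρ : Representation ℂ (borel n) N)
    (x : Fin n → ℂˣ) : ℂ :=
  character ρ.dual x

/-! ### The flagged Weyl module -/

/-- The polynomial ring `ℂ[Y]` in the indeterminates `y_{ij}`, `i ≤ j`. -/
abbrev CoordRing (n : ℕ) : Type :=
  MvPolynomial {p : Fin n × Fin n // p.1 ≤ p.2} ℂ

/-- The upper-triangular matrix `Y` of indeterminates. -/
def genericUpper (n : ℕ) : Matrix (Fin n) (Fin n) (CoordRing n) :=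
  Matrix.of fun i j => if h : i ≤ j then MvPolynomial.X ⟨(i, j), h⟩ else 0

/-- The matrix `g⁻¹ Y`. -/
def invMulGeneric (g : borel n) : Matrix (Fin n) (Fin n) (CoordRing n) :=
  ((g⁻¹ : borel n) : GL (Fin n) ℂ).val.map MvPolynomial.C * genericUpper n

/-- The substitution `f(Y) ↦ f(g⁻¹ Y)` on `ℂ[Y]`. -/
def translate (g : borel n) : CoordRing n →ₐ[ℂ] CoordRing n :=
  MvPolynomial.aeval fun p => invMulGeneric g p.1.1 p.1.2

theorem invMulGeneric_eq_zero (g : borel n) {i j : Fin n} (h : j < i) :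
    invMulGeneric g i j = 0 := by
  rw [invMulGeneric, Matrix.mul_apply]
  refine Finset.sum_eq_zero fun k _ => ?_
  by_cases hk : k < i
  · have := (g⁻¹ : borel n).2 i k hk
    rw [Matrix.map_apply]
    erw [this]
    simp
  · have : ¬ k ≤ j := fun hkj => hk (hkj.trans_lt h)
    simp [genericUpper, this]

theorem translate_genericUpper (g : borel n) (i j : Fin n) :
    translate g (genericUpper n i j) = invMulGeneric g i j := by
  by_cases h : i ≤ j
  · simp [genericUpper, h, translate]
  · rw [invMulGeneric_eq_zero g (not_le.1 h)]
    simp [genericUpper, h]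

/-- The action of `B` on `ℂ[Y]`, where `g` sends `f(Y)` to `f(g⁻¹ Y)`. -/
def coordRep (n : ℕ) : Representation ℂ (borel n) (CoordRing n) where
  toFun g := (translate g).toLinearMap
  map_one' := by
    have : translate (1 : borel n) = AlgHom.id ℂ (CoordRing n) := by
      apply MvPolynomial.algHom_ext
      rintro ⟨⟨i, j⟩, h⟩
      have h' : i ≤ j := h
      have e : (((1 : borel n)⁻¹ : borel n) : GL (Fin n) ℂ).val.map
          (MvPolynomial.C : ℂ →+* CoordRing n) = 1 := by
        rw [inv_one]
        exact Matrix.map_one _ (map_zero _) (map_one _)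
      simp only [translate, MvPolynomial.aeval_X, AlgHom.coe_id, id_eq]
      rw [invMulGeneric, e, one_mul]
      simp [genericUpper, h']
    rw [this]; rfl
  map_mul' g h := by
    have : translate (g * h) = (translate g).comp (translate h) := by
      apply MvPolynomial.algHom_ext
      rintro ⟨⟨i, j⟩, hij⟩
      have e : (translate h) (MvPolynomial.X ⟨(i, j), hij⟩) = invMulGeneric h i j := by
        simp [translate]
      have e' : (translate (g * h)) (MvPolynomial.X ⟨(i, j), hij⟩) =
          invMulGeneric (g * h) i j := by
        simp [translate]
      rw [AlgHom.comp_apply, e, e']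
      have e2 : invMulGeneric (g * h) =
          ((h⁻¹ : borel n) : GL (Fin n) ℂ).val.map MvPolynomial.C * invMulGeneric g := by
        rw [invMulGeneric, invMulGeneric, ← Matrix.mul_assoc, ← Matrix.map_mul, mul_inv_rev]
        rfl
      rw [e2]
      conv_rhs => rw [invMulGeneric]
      rw [Matrix.mul_apply, Matrix.mul_apply, map_sum]
      refine Finset.sum_congr rfl fun k _ => ?_
      rw [map_mul, translate_genericUpper, Matrix.map_apply, ← MvPolynomial.algebraMap_eq,
        AlgHom.commutes]
    rw [this]; rfl

/-- The minor of `Y` with rows `S` and columns `R`. -/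
def minor (R S : Finset (Fin n)) (h : S.card = R.card) : CoordRing n :=
  ((genericUpper n).submatrix (S.orderEmbOfFin h) (R.orderEmbOfFin rfl)).det

/-- The subspace `M_D` of `ℂ[Y]` spanned by the products of minors `∏_j det(Y_{D_j}^{C_j})`
over all `C ≤ D`. -/
def weylSubmodule (D : Fin n → Finset (Fin n)) : Submodule ℂ (CoordRing n) :=
  Submodule.span ℂ
    {f | ∃ (C : Fin n → Finset (Fin n)) (h : ∀ j, GaleLE (C j) (D j)),
      f = ∏ j, minor (D j) (C j) (h j).fst}

/-- The span of the minors of `Y` with columns `R` and rows `S ≤ R`. -/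
def minorSpan (R : Finset (Fin n)) : Submodule ℂ (CoordRing n) :=
  Submodule.span ℂ {f | ∃ (S : Finset (Fin n)) (h : GaleLE S R), f = minor R S h.fst}

theorem weylSubmodule_eq_prod (D : Fin n → Finset (Fin n)) :
    weylSubmodule D = ∏ j, minorSpan (D j) := by
  unfold minorSpan
  rw [Submodule.prod_span, weylSubmodule]
  congr 1
  ext f
  rw [Set.mem_fintype_prod, Set.mem_ofPred_eq]
  constructor
  · rintro ⟨C, h, rfl⟩
    exact ⟨fun j => minor (D j) (C j) (h j).fst, fun j => ⟨C j, h j, rfl⟩, rfl⟩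
  · rintro ⟨g, hg, rfl⟩
    choose C h e using hg
    exact ⟨C, h, Finset.prod_congr rfl fun j _ => e j⟩

theorem det_rows_mem_minorSpan (R : Finset (Fin n)) (f : Fin R.card → Fin n) :
    ((genericUpper n).submatrix f (R.orderEmbOfFin rfl)).det ∈ minorSpan R := by
  classical
  by_cases h0 : ((genericUpper n).submatrix f (R.orderEmbOfFin rfl)).det = 0
  · rw [h0]; exact Submodule.zero_mem _
  have hinj : Function.Injective f := by
    intro a b hab
    by_contra hne
    refine h0 (Matrix.det_zero_of_row_eq hne ?_)
    ext k
    simp [hab]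
  have hcard : (Finset.univ.image f).card = R.card := by
    rw [Finset.card_image_of_injective _ hinj, Finset.card_univ, Fintype.card_fin]
  obtain ⟨σ, hσ⟩ : ∃ σ : Equiv.Perm (Fin R.card),
      ∀ k, f (σ k) ≤ R.orderEmbOfFin rfl k := by
    by_contra hno
    push Not at hno
    refine h0 ?_
    rw [Matrix.det_apply]
    refine Finset.sum_eq_zero fun σ _ => ?_
    obtain ⟨k, hk⟩ := hno σ
    rw [Finset.prod_eq_zero (Finset.mem_univ k), smul_zero]
    simp [genericUpper, not_le.2 hk]
  have hle : GaleLE (Finset.univ.image f) R := by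
    rw [galeLE_iff]
    refine ⟨hcard, fun m => ?_⟩
    rw [card_filter_le_eq R rfl]
    refine Finset.card_le_card_of_injOn (fun k => f (σ k)) ?_ ?_
    · intro k hk
      simp only [Finset.coe_filter, Finset.mem_univ, true_and, Set.mem_ofPred_eq] at hk
      simp only [Finset.coe_filter, Set.mem_ofPred_eq]
      exact ⟨Finset.mem_image_of_mem _ (Finset.mem_univ _), (hσ k).trans hk⟩
    · exact (hinj.comp σ.injective).injOn
  have hmem : ∀ k, ∃ l, (Finset.univ.image f).orderEmbOfFin hcard l = f k := by
    intro k
    have : f k ∈ Set.range ((Finset.univ.image f).orderEmbOfFin hcard) := by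
      rw [Finset.range_orderEmbOfFin]; simp
    exact this
  choose τ hτ using hmem
  have hτinj : Function.Injective τ := fun a b hab => hinj (by rw [← hτ, ← hτ, hab])
  let τ' : Equiv.Perm (Fin R.card) :=
    Equiv.ofBijective τ (Finite.injective_iff_bijective.1 hτinj)
  have e : (genericUpper n).submatrix f (R.orderEmbOfFin rfl) =
      ((genericUpper n).submatrix ((Finset.univ.image f).orderEmbOfFin hcard)
        (R.orderEmbOfFin rfl)).submatrix τ' id := by
    ext1 a b
    simp [τ', hτ]
  rw [e, Matrix.det_permute]
  have hm : minor R (Finset.univ.image f) hle.fst ∈ minorSpan R :=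
    Submodule.subset_span ⟨_, hle, rfl⟩
  have hm2 := (minorSpan R).smul_mem (((Equiv.Perm.sign τ' : ℤˣ) : ℤ) : ℂ) hm
  convert hm2 using 1
  rw [MvPolynomial.smul_eq_C_mul]
  simp [minor]

theorem translate_minor_mem (g : borel n) (R S : Finset (Fin n)) (h : S.card = R.card) :
    translate g (minor R S h) ∈ minorSpan R := by
  classical
  set A : Matrix (Fin n) (Fin n) ℂ := ((g⁻¹ : borel n) : GL (Fin n) ℂ).val with hA
  have e : translate g (minor R S h) =
      (Matrix.of fun k => ∑ i, (MvPolynomial.C (A (S.orderEmbOfFin h k) i) : CoordRing n) •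
        fun l => genericUpper n i (R.orderEmbOfFin rfl l)).det := by
    rw [minor, AlgHom.map_det]
    congr 1
    ext1 k l
    rw [AlgHom.mapMatrix_apply, Matrix.map_apply, Matrix.submatrix_apply,
      translate_genericUpper, invMulGeneric, Matrix.mul_apply]
    simp [hA]
  rw [e]
  have e2 := (Matrix.detRowAlternating (n := Fin R.card)
    (R := CoordRing n)).toMultilinearMap.map_sum
    (fun k i => (MvPolynomial.C (A (S.orderEmbOfFin h k) i) : CoordRing n) •
        fun l => genericUpper n i (R.orderEmbOfFin rfl l))
  refine (congrArg (· ∈ minorSpan R) e2).mpr ?_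
  refine Submodule.sum_mem _ fun f _ => ?_
  rw [MultilinearMap.map_smul_univ, ← map_prod, smul_eq_mul, ← MvPolynomial.smul_eq_C_mul]
  exact Submodule.smul_mem _ _ (det_rows_mem_minorSpan R f)

theorem translate_mem_weylSubmodule (D : Fin n → Finset (Fin n)) (g : borel n)
    {f : CoordRing n} (hf : f ∈ weylSubmodule D) : translate g f ∈ weylSubmodule D := by
  suffices h : weylSubmodule D ≤ (weylSubmodule D).comap (translate g).toLinearMap from h hf
  conv_lhs => rw [weylSubmodule]
  rw [Submodule.span_le]
  rintro _ ⟨C, h, rfl⟩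
  change translate g _ ∈ weylSubmodule D
  rw [weylSubmodule_eq_prod, map_prod]
  generalize (Finset.univ : Finset (Fin n)) = s
  classical
  induction s using Finset.induction_on with
  | empty => simpa using ⟨1, map_one _⟩
  | insert a s ha ih =>
    rw [Finset.prod_insert ha, Finset.prod_insert ha]
    exact Submodule.mul_mem_mul (translate_minor_mem g _ _ _) ih

/-- The flagged Weyl module `M_D` as a subrepresentation of `ℂ[Y]`. -/
def weylSubrep (D : Fin n → Finset (Fin n)) : Subrepresentation (coordRep n) where
  toSubmodule := weylSubmodule D
  apply_mem_toSubmodule g _ hv := translate_mem_weylSubmodule D g hv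

/-- The flagged Weyl module `M_D` as a representation of `B`. -/
def weylModule (D : Fin n → Finset (Fin n)) :
    Representation ℂ (borel n) (weylSubrep D).toSubmodule :=
  (weylSubrep D).toRepresentation

/-- The polynomial `χ` is the dual character of `M_D`: it agrees with
`char*(M_D)(x_1, …, x_n)` for all nonzero `x_1, …, x_n`. -/
def IsDualCharacter (D : Fin n → Finset (Fin n)) (χ : MvPolynomial (Fin n) ℂ) : Prop :=
  ∀ x : Fin n → ℂˣ,
    MvPolynomial.eval (fun i => (x i : ℂ)) χ = dualCharacter (weylModule D) x

end FlaggedWeyl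

end

/-! A diagonal matrix scales the rows of `Y`, so every product of minors with `C ≤ D` is a torus
eigenvector, and it is nonzero. The dual character reads its eigenvalue as the monomial `∏_j ∏_{i ∈
C_j} x_i`. A basis of `M_D` chosen among these products turns `χ_D` into a sum of monomials, one per
basis vector, which gives existence and positive integer coefficients. Linear relations between the
products cannot remove a weight: a discarded product is a nonzero combination of basis vectors of
its own weight. Hence the support is exactly the set of sums `∑_j 1_{C_j}` with `C_j ≤ D_j`
(`exists_character_polynomial`), the Minkowski sum of the sets of base indicators of the Schubert
matroids.

The rest concerns submodular functions. A matroid polytope is the base polytope of its rank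
function. A base polytope is the convex hull of its greedy vertices (`basePolytope_eq_convexHull`).
These depend additively on the function, so base polytopes add under Minkowski sum
(`basePolytope_sum`), and they move correctly under adjacent transpositions, which makes the hull a
generalized permutahedron. SNP is an integer decomposition property: the discrete sandwich theorem
splits a lattice point of the sum into lattice points of the summands
(`exists_sum_eq_of_forall_sum_le`), and each of those is the indicator of a base. -/

open scoped Pointwise

noncomputable section

namespace FlaggedWeyl

/-! ### Submodular set functions -/

section Sandwich

variable {α : Type*} [DecidableEq α]

/-- Submodularity of a set function on finite sets. -/
def IsSubmodular {R : Type*} [Add R] [LE R] (f : Finset α → R) : Prop :=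
  ∀ I J, f (I ∪ J) + f (I ∩ J) ≤ f I + f J

/-- The discrete sandwich theorem, for set functions on the subsets of `s`. -/
theorem exists_modular_between_of_subset (s : Finset α) : ∀ f g : Finset α → ℤ,
    f ∅ = 0 → g ∅ = 0 → (∀ I ⊆ s, g I ≤ f I) →
    (∀ I ⊆ s, ∀ J ⊆ s, f (I ∪ J) + f (I ∩ J) ≤ f I + f J) →
    (∀ I ⊆ s, ∀ J ⊆ s, g I + g J ≤ g (I ∪ J) + g (I ∩ J)) →
    ∃ m : α → ℤ, ∀ I ⊆ s, g I ≤ ∑ i ∈ I, m i ∧ ∑ i ∈ I, m i ≤ f I := by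
  induction s using Finset.induction_on with
  | empty =>
    intro f g hf hg _ _ _
    refine ⟨0, fun I hI => ?_⟩
    obtain rfl := Finset.subset_empty.1 hI
    simp [hf, hg]
  | insert e s he ih =>
    intro f g hf hg hgf hsub hsup
    have hs : ∀ {I}, I ⊆ s → I ⊆ insert e s := fun h => h.trans (Finset.subset_insert _ _)
    have hs' : ∀ {I}, I ⊆ s → insert e I ⊆ insert e s := fun h => Finset.insert_subset_insert _ h
    have hi : ∀ {I J : Finset α}, I ⊆ s → I ∩ insert e J = I ∩ J := fun h =>
      Finset.inter_insert_of_notMem fun h' => he (h h')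
    -- The value `a` of the modular function at `e`. Every lower bound lies below every upper bound:
    -- add supermodularity of `g` at `J`, `I ∪ {e}` to submodularity of `f` at `I`, `J ∪ {e}`, and
    -- use `g ≤ f` on the union and the intersection. The largest lower bound is an integer.
    obtain ⟨a, hlo, hup⟩ : ∃ a : ℤ, (∀ I ⊆ s, g (insert e I) - f I ≤ a) ∧
        ∀ J ⊆ s, a ≤ f (insert e J) - g J := by
      have hne : s.powerset.Nonempty := ⟨∅, by simp⟩
      refine ⟨s.powerset.sup' hne fun I => g (insert e I) - f I, fun I hI =>
        Finset.le_sup' (fun I => g (insert e I) - f I) (Finset.mem_powerset.2 hI),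
        fun J hJ => Finset.sup'_le _ _ fun I hI => ?_⟩
      rw [Finset.mem_powerset] at hI
      have h1 := hsup _ (hs hJ) _ (hs' hI)
      have h2 := hsub _ (hs hI) _ (hs' hJ)
      rw [hi hJ, Finset.union_insert, Finset.union_comm, Finset.inter_comm] at h1
      rw [hi hI, Finset.union_insert] at h2
      have h3 := hgf _ (hs' (Finset.union_subset hI hJ))
      have h4 := hgf _ (hs (Finset.inter_subset_left.trans hI : I ∩ J ⊆ s))
      lia
    -- With `m e = a` fixed, the conditions at `I` and at `I ∪ {e}` together bound `m` on `I ⊆ s` by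
    -- this `min` and `max`. They are again sub- and supermodular, by the four cases of which term
    -- attains the extremum at `I` and at `J`.
    obtain ⟨m, hm⟩ := ih (fun I => min (f I) (f (insert e I) - a))
      (fun I => max (g I) (g (insert e I) - a))
      (by
        have := hup ∅ (by simp)
        simp only [hf, hg] at this ⊢
        lia)
      (by
        have := hlo ∅ (by simp)
        simp only [hf, hg] at this ⊢
        lia)
      (by
        intro I hI
        have := hlo I hI
        have := hup I hI
        have := hgf _ (hs hI)
        have := hgf _ (hs' hI)
        lia)
      (by
        intro I hI J hJ
        have h1 := hsub _ (hs hI) _ (hs hJ)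
        have h2 := hsub _ (hs hI) _ (hs' hJ)
        have h3 := hsub _ (hs hJ) _ (hs' hI)
        have h4 := hsub _ (hs' hI) _ (hs' hJ)
        rw [hi hI, Finset.union_insert] at h2
        rw [hi hJ, Finset.union_insert, Finset.union_comm, Finset.inter_comm] at h3
        rw [← Finset.insert_union_distrib, ← Finset.insert_inter_distrib] at h4
        lia)
      (by
        intro I hI J hJ
        have h1 := hsup _ (hs hI) _ (hs hJ)
        have h2 := hsup _ (hs hI) _ (hs' hJ)
        have h3 := hsup _ (hs hJ) _ (hs' hI)
        have h4 := hsup _ (hs' hI) _ (hs' hJ)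
        rw [hi hI, Finset.union_insert] at h2
        rw [hi hJ, Finset.union_insert, Finset.union_comm, Finset.inter_comm] at h3
        rw [← Finset.insert_union_distrib, ← Finset.insert_inter_distrib] at h4
        lia)
    refine ⟨Function.update m e a, fun I hI => ?_⟩
    have hsum : ∀ J ⊆ s, ∑ i ∈ J, Function.update m e a i = ∑ i ∈ J, m i := fun J hJ =>
      Finset.sum_congr rfl fun i hiJ =>
        Function.update_of_ne (fun h : i = e => he (hJ (h ▸ hiJ))) _ _
    by_cases heI : e ∈ I
    · obtain ⟨J, heJ, rfl⟩ : ∃ J, e ∉ J ∧ insert e J = I :=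
        ⟨I.erase e, Finset.notMem_erase _ _, Finset.insert_erase heI⟩
      have hJ : J ⊆ s := by
        intro x hx
        exact Finset.mem_of_mem_insert_of_ne (hI (Finset.mem_insert_of_mem hx))
          (by rintro rfl; exact heJ hx)
      rw [Finset.sum_insert heJ, hsum J hJ, Function.update_self]
      have := hm J hJ
      lia
    · have hIs : I ⊆ s := fun x hx =>
        Finset.mem_of_mem_insert_of_ne (hI hx) fun h : x = e => heI (h ▸ hx)
      rw [hsum I hIs]
      have := hm I hIs
      lia

/-- Integer points of the base polytope of a sum of submodular functions decompose. -/
theorem exists_sum_eq_of_forall_sum_le [Fintype α] {ι : Type*} (f : ι → Finset α → ℤ)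
    (hf : ∀ j, IsSubmodular (f j)) (h0 : ∀ j, f j ∅ = 0) (s : Finset ι) :
    ∀ p : α → ℤ, (∀ I, ∑ i ∈ I, p i ≤ ∑ j ∈ s, f j I) →
      ∑ i, p i = ∑ j ∈ s, f j Finset.univ →
      ∃ q : ι → α → ℤ, (∀ j ∈ s, (∀ I, ∑ i ∈ I, q j i ≤ f j I) ∧
        ∑ i, q j i = f j Finset.univ) ∧ ∑ j ∈ s, q j = p := by
  classical
  induction s using Finset.induction_on with
  | empty =>
    intro p hp hp'
    refine ⟨0, by simp, ?_⟩
    have hle : ∀ i, p i ≤ 0 := fun i => by simpa using hp {i}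
    simp only [Finset.sum_empty] at hp' ⊢
    ext i
    exact ((Finset.sum_eq_zero_iff_of_nonpos fun i _ => hle i).1 hp' i (Finset.mem_univ i)).symm
  | insert a s ha ih =>
    intro p hp hp'
    simp only [Finset.sum_insert ha] at hp hp'
    -- The lower bound is exactly the condition that `p - m` satisfy the constraints of the
    -- remaining summands. It is supermodular, being modular minus submodular. At the full set both
    -- bounds coincide, which forces the equality for `m`.
    obtain ⟨m, hm⟩ := exists_modular_between_of_subset Finset.univ (f a)
      (fun I => ∑ i ∈ I, p i - ∑ j ∈ s, f j I) (h0 a) (by simp [h0])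
      (fun I _ => by have := hp I; lia) (fun I _ J _ => hf a I J)
      (fun I _ J _ => by
        have h1 := Finset.sum_union_inter (s₁ := I) (s₂ := J) (f := p)
        have h2 : ∑ j ∈ s, f j (I ∪ J) + ∑ j ∈ s, f j (I ∩ J) ≤
            ∑ j ∈ s, f j I + ∑ j ∈ s, f j J := by
          rw [← Finset.sum_add_distrib, ← Finset.sum_add_distrib]
          exact Finset.sum_le_sum fun j _ => hf j I J
        lia)
    have hmu : ∑ i, m i = f a Finset.univ := by
      have := hm Finset.univ subset_rfl
      lia
    obtain ⟨q, hq, hqp⟩ := ih (p - m)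
      (fun I => by
        have := hm I (Finset.subset_univ I)
        simp only [Pi.sub_apply, Finset.sum_sub_distrib]
        lia)
      (by
        simp only [Pi.sub_apply, Finset.sum_sub_distrib]
        lia)
    refine ⟨Function.update q a m, fun j hj => ?_, ?_⟩
    · rcases eq_or_ne j a with rfl | hja
      · rw [Function.update_self]
        exact ⟨fun I => (hm I (Finset.subset_univ I)).2, hmu⟩
      · rw [Function.update_of_ne hja]
        exact hq j (Finset.mem_of_mem_insert_of_ne hj hja)
    · rw [Finset.sum_insert ha, Function.update_self, Finset.sum_congr rfl fun j hj =>
        Function.update_of_ne (fun h : j = a => ha (h ▸ hj)) m q, hqp]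
      abel

end Sandwich

/-! ### Base polytopes and greedy vertices -/

variable {n : ℕ}

/-- The base polytope of a set function. -/
def basePolytope (f : Finset (Fin n) → ℝ) : Set (Fin n → ℝ) :=
  {t | (∀ I, ∑ i ∈ I, t i ≤ f I) ∧ ∑ i, t i = f Finset.univ}

/-- The greedy vertex of the base polytope that maximizes the functionals whose coefficients
are weakly increasing along `π`. -/
def greedy (f : Finset (Fin n) → ℝ) (π : Equiv.Perm (Fin n)) : Fin n → ℝ := fun i =>
  f {j | π i ≤ π j} - f {j | π i < π j}

theorem convex_basePolytope (f : Finset (Fin n) → ℝ) : Convex ℝ (basePolytope f) := by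
  rintro x ⟨hx, hx'⟩ y ⟨hy, hy'⟩ a b ha hb hab
  have key : ∀ I : Finset (Fin n),
      ∑ i ∈ I, (a • x + b • y) i = a * ∑ i ∈ I, x i + b * ∑ i ∈ I, y i := fun I => by
    simp [Finset.sum_add_distrib, Finset.mul_sum]
  refine ⟨fun I => ?_, ?_⟩
  · rw [key]
    calc _ ≤ a * f I + b * f I :=
          add_le_add (mul_le_mul_of_nonneg_left (hx I) ha) (mul_le_mul_of_nonneg_left (hy I) hb)
      _ = f I := by rw [← add_mul, hab, one_mul]
  · rw [key, hx', hy', ← add_mul, hab, one_mul]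

/-- Diminishing returns: with elements added in decreasing order of `π`, the increment of `f` on
adding `a` to `s` is at least its increment on adding `a` to the full set of elements above `a`, and
the latter is the greedy coordinate. -/
theorem sum_greedy_le {f : Finset (Fin n) → ℝ} (hf : IsSubmodular f) (h0 : f ∅ = 0)
    (π : Equiv.Perm (Fin n)) (I : Finset (Fin n)) : ∑ i ∈ I, greedy f π i ≤ f I := by
  induction I using Finset.induction_on_min_value π with
  | empty => simp [h0]
  | insert a s ha hmin ih =>
    have hlt : ∀ x ∈ s, π a < π x := fun x hx =>
      lt_of_le_of_ne (hmin x hx) fun h => ha (π.injective h ▸ hx)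
    have h1 := hf {j | π a < π j} (insert a s)
    have e1 : ({j | π a < π j} : Finset (Fin n)) ∪ insert a s =
        ({j | π a ≤ π j} : Finset (Fin n)) := by
      ext x
      simp only [Finset.mem_union, Finset.mem_filter, Finset.mem_univ, true_and,
        Finset.mem_insert]
      constructor
      · rintro (h | rfl | h)
        exacts [h.le, le_rfl, hmin _ h]
      · intro h
        rcases h.lt_or_eq with h | h
        exacts [Or.inl h, Or.inr (Or.inl (π.injective h).symm)]
    have e2 : ({j | π a < π j} : Finset (Fin n)) ∩ insert a s = s := by
      ext x
      simp only [Finset.mem_inter, Finset.mem_filter, Finset.mem_univ, true_and,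
        Finset.mem_insert]
      constructor
      · rintro ⟨h, rfl | h'⟩
        exacts [absurd h (lt_irrefl _), h']
      · exact fun h => ⟨hlt _ h, Or.inr h⟩
    rw [e1, e2] at h1
    rw [Finset.sum_insert ha, greedy]
    linarith

/-- On a set closed upwards for `π` the greedy increments telescope; submodularity plays no role. -/
theorem sum_greedy_of_upper {f : Finset (Fin n) → ℝ} (h0 : f ∅ = 0)
    (π : Equiv.Perm (Fin n)) (I : Finset (Fin n))
    (hI : ∀ i ∈ I, ∀ j, π i ≤ π j → j ∈ I) : ∑ i ∈ I, greedy f π i = f I := by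
  induction I using Finset.induction_on_min_value π with
  | empty => simp [h0]
  | insert a s ha hmin ih =>
    have hlt : ∀ x ∈ s, π a < π x := fun x hx =>
      lt_of_le_of_ne (hmin x hx) fun h => ha (π.injective h ▸ hx)
    have e2 : ({j | π a < π j} : Finset (Fin n)) = s := by
      ext x
      simp only [Finset.mem_filter, Finset.mem_univ, true_and]
      exact ⟨fun h => Finset.mem_of_mem_insert_of_ne
        (hI a (Finset.mem_insert_self _ _) x h.le) (fun h' => h.ne (h' ▸ rfl)), hlt x⟩
    have e1 : ({j | π a ≤ π j} : Finset (Fin n)) = insert a s := by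
      ext x
      simp only [Finset.mem_filter, Finset.mem_univ, true_and]
      refine ⟨hI a (Finset.mem_insert_self _ _) x, fun h => ?_⟩
      rcases Finset.mem_insert.1 h with rfl | h
      exacts [le_rfl, hmin _ h]
    rw [Finset.sum_insert ha, greedy, e1, e2, ih]
    · ring
    · intro i hi j hij
      refine Finset.mem_of_mem_insert_of_ne (hI i (Finset.mem_insert_of_mem hi) j hij) ?_
      rintro rfl
      exact absurd hij (not_le.2 (hlt i hi))

theorem greedy_mem_basePolytope {f : Finset (Fin n) → ℝ} (hf : IsSubmodular f) (h0 : f ∅ = 0)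
    (π : Equiv.Perm (Fin n)) : greedy f π ∈ basePolytope f :=
  ⟨sum_greedy_le hf h0 π, sum_greedy_of_upper h0 π _ fun _ _ _ _ => Finset.mem_univ _⟩

/-- Abel summation: nonnegative tail sums pair nonnegatively with increasing coefficients. -/
theorem mul_sum_le_sum_mul_of_upper (π : Equiv.Perm (Fin n)) (c d : Fin n → ℝ)
    (hc : ∀ i j, π i ≤ π j → c i ≤ c j)
    (hd : ∀ I : Finset (Fin n), (∀ i ∈ I, ∀ j, π i ≤ π j → j ∈ I) → 0 ≤ ∑ i ∈ I, d i)
    (I : Finset (Fin n)) : (∀ i ∈ I, ∀ j, π i ≤ π j → j ∈ I) →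
    ∀ b, (∀ i ∈ I, b ≤ c i) → b * ∑ i ∈ I, d i ≤ ∑ i ∈ I, c i * d i := by
  induction I using Finset.induction_on_min_value π with
  | empty => simp
  | insert a s ha hmin ih =>
    intro hI b hb
    have hs : ∀ i ∈ s, ∀ j, π i ≤ π j → j ∈ s := by
      intro i hi j hij
      refine Finset.mem_of_mem_insert_of_ne (hI i (Finset.mem_insert_of_mem hi) j hij) ?_
      rintro rfl
      exact ha (π.injective (le_antisymm hij (hmin i hi)) ▸ hi)
    have h1 := ih hs (c a) fun i hi => hc a i (hmin i hi)
    have h2 := mul_le_mul_of_nonneg_right (hb a (Finset.mem_insert_self _ _)) (hd _ hI)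
    rw [Finset.sum_insert ha] at h2 ⊢
    rw [Finset.sum_insert ha]
    linarith

/-- A point outside the hull would be strictly separated from it by a linear functional. Yet the
greedy vertex for an order sorting the coefficients already maximizes that functional over the base
polytope. -/
theorem basePolytope_eq_convexHull {f : Finset (Fin n) → ℝ} (hf : IsSubmodular f)
    (h0 : f ∅ = 0) : basePolytope f = convexHull ℝ (Set.range (greedy f)) := by
  apply Set.Subset.antisymm
  · intro t ht
    by_contra hnot
    obtain ⟨l, u, hl, hu⟩ := geometric_hahn_banach_closed_point
      (convex_convexHull ℝ (Set.range (greedy f)))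
      ((Set.finite_range (greedy f)).isClosed_convexHull ℝ) hnot
    set c : Fin n → ℝ := fun i => l (Pi.single i 1) with hc
    have hlc : ∀ x : Fin n → ℝ, l x = ∑ i, c i * x i := by
      intro x
      conv_lhs => rw [pi_eq_sum_univ' x, map_sum]
      simp only [map_smul, smul_eq_mul, hc]
      refine Finset.sum_congr rfl fun i _ => ?_
      rw [mul_comm]
    -- `Tuple.sort c` sends positions to indices, so its inverse ranks the indices by increasing
    -- coefficient.
    set π : Equiv.Perm (Fin n) := (Tuple.sort c)⁻¹ with hπ
    have hmono : ∀ i j, π i ≤ π j → c i ≤ c j := by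
      intro i j hij
      simpa [hπ] using Tuple.monotone_sort c hij
    -- Any lower bound serves: it gets multiplied by the total of `greedy f π - t`, which is zero.
    obtain ⟨b, hb⟩ := (Set.finite_range c).bddBelow
    have h1 := mul_sum_le_sum_mul_of_upper π c (greedy f π - t) hmono
      (fun I hI => by
        simp only [Pi.sub_apply, Finset.sum_sub_distrib]
        rw [sum_greedy_of_upper h0 π I hI]
        exact sub_nonneg.2 (ht.1 I))
      Finset.univ (fun _ _ _ _ => Finset.mem_univ _) b (fun i _ => hb ⟨i, rfl⟩)
    have h2 : ∑ i, (greedy f π - t) i = 0 := by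
      simp only [Pi.sub_apply, Finset.sum_sub_distrib]
      rw [(greedy_mem_basePolytope hf h0 π).2, ht.2, sub_self]
    rw [h2, mul_zero, ← hlc, map_sub] at h1
    have h3 := hl _ (subset_convexHull ℝ _ ⟨π, rfl⟩)
    linarith
  · refine convexHull_min ?_ (convex_basePolytope f)
    rintro _ ⟨π, rfl⟩
    exact greedy_mem_basePolytope hf h0 π

theorem isSubmodular_sum {ι : Type*} (s : Finset ι) {f : ι → Finset (Fin n) → ℝ}
    (hf : ∀ j, IsSubmodular (f j)) : IsSubmodular (∑ j ∈ s, f j) := by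
  intro I J
  simp only [Finset.sum_apply]
  rw [← Finset.sum_add_distrib, ← Finset.sum_add_distrib]
  exact Finset.sum_le_sum fun j _ => hf j I J

theorem greedy_sum {ι : Type*} (s : Finset ι) (f : ι → Finset (Fin n) → ℝ)
    (π : Equiv.Perm (Fin n)) : greedy (∑ j ∈ s, f j) π = ∑ j ∈ s, greedy (f j) π := by
  ext i
  simp [greedy, Finset.sum_apply]

/-- Base polytopes of submodular functions are additive under Minkowski sum. -/
theorem basePolytope_sum {ι : Type*} (s : Finset ι) {f : ι → Finset (Fin n) → ℝ}
    (hf : ∀ j, IsSubmodular (f j)) (h0 : ∀ j, f j ∅ = 0) :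
    basePolytope (∑ j ∈ s, f j) = ∑ j ∈ s, basePolytope (f j) := by
  classical
  apply Set.Subset.antisymm
  · rw [basePolytope_eq_convexHull (isSubmodular_sum s hf) (by simp [Finset.sum_apply, h0]),
      Finset.sum_congr rfl fun j _ => basePolytope_eq_convexHull (hf j) (h0 j),
      ← convexHull_sum]
    refine convexHull_mono ?_
    rintro _ ⟨π, rfl⟩
    rw [greedy_sum]
    exact Set.finsetSum_mem_finsetSum _ _ _ fun j _ => ⟨π, rfl⟩
  · intro t ht
    obtain ⟨g, hg, rfl⟩ := (Set.mem_finsetSum _ _ _).1 ht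
    refine ⟨fun I => ?_, ?_⟩
    · simp only [Finset.sum_apply]
      rw [Finset.sum_comm]
      exact Finset.sum_le_sum fun j hj => (hg hj).1 I
    · simp only [Finset.sum_apply]
      rw [Finset.sum_comm]
      exact Finset.sum_congr rfl fun j hj => (hg hj).2

/-- Exchanging two elements `x`, `y` of consecutive rank leaves the upper sets of every other
element unchanged, so only the coordinates at `x` and `y` move, by opposite amounts. -/
theorem isGeneralizedPermutahedron_basePolytope {f : Finset (Fin n) → ℝ} (hf : IsSubmodular f)
    (h0 : f ∅ = 0) : IsGeneralizedPermutahedron (basePolytope f) := by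
  refine ⟨greedy f, basePolytope_eq_convexHull hf h0, fun π k l hkl => ?_⟩
  obtain ⟨x, rfl⟩ := π.surjective k
  obtain ⟨y, rfl⟩ := π.surjective l
  have hlt : π x < π y := by rw [Fin.lt_def]; omega
  have hxy : x ≠ y := by rintro rfl; exact lt_irrefl _ hlt
  set U : Finset (Fin n) := {j | π y < π j} with hU
  have hσx : (Equiv.swap (π x) (π y) * π) x = π y := by simp
  have hσy : (Equiv.swap (π x) (π y) * π) y = π x := by simp
  have hσ : ∀ z, z ≠ x → z ≠ y → (Equiv.swap (π x) (π y) * π) z = π z := fun z hx hy => by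
    rw [Equiv.Perm.mul_apply, Equiv.swap_apply_of_ne_of_ne (π.injective.ne hx)
      (π.injective.ne hy)]
  have hval : ∀ z, z ≠ x → z ≠ y → (π z : ℕ) ≠ π x ∧ (π z : ℕ) ≠ π y := fun z hx hy =>
    ⟨fun h => hx (π.injective (Fin.ext h)), fun h => hy (π.injective (Fin.ext h))⟩
  have hcase : ∀ z, z = x ∨ z = y ∨ (z ≠ x ∧ z ≠ y) := fun z => by tauto
  have sx1 : ({j | π x ≤ π j} : Finset (Fin n)) = insert x (insert y U) := by
    ext z
    rcases hcase z with rfl | rfl | ⟨h1, h2⟩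
    · simp
    · simp [hlt.le]
    · have := hval z h1 h2
      simp only [hU, Finset.mem_filter, Finset.mem_univ, true_and, Finset.mem_insert, h1, h2,
        false_or, Fin.le_def, Fin.lt_def]
      omega
  have sx2 : ({j | π x < π j} : Finset (Fin n)) = insert y U := by
    ext z
    rcases hcase z with rfl | rfl | ⟨h1, h2⟩
    · simp [hU, hxy, hlt.le]
    · simp [hlt]
    · have := hval z h1 h2
      simp only [hU, Finset.mem_filter, Finset.mem_univ, true_and, Finset.mem_insert, h2,
        false_or, Fin.lt_def]
      omega
  have sy1 : ({j | π y ≤ π j} : Finset (Fin n)) = insert y U := by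
    ext z
    rcases hcase z with rfl | rfl | ⟨h1, h2⟩
    · simp [hU, hxy, not_le.2 hlt, not_lt.2 hlt.le]
    · simp
    · have := hval z h1 h2
      simp only [hU, Finset.mem_filter, Finset.mem_univ, true_and, Finset.mem_insert, h2,
        false_or, Fin.le_def, Fin.lt_def]
      omega
  have tx1 : ({j | π y ≤ (Equiv.swap (π x) (π y) * π) j} : Finset (Fin n)) = insert x U := by
    ext z
    rcases hcase z with rfl | rfl | ⟨h1, h2⟩
    · simp only [Finset.mem_filter, Finset.mem_univ, true_and, hσx]
      simp
    · simp only [Finset.mem_filter, Finset.mem_univ, true_and, hσy]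
      simp [hU, hxy.symm, hlt]
    · have := hval z h1 h2
      simp only [hU, Finset.mem_filter, Finset.mem_univ, true_and, Finset.mem_insert, h1,
        false_or, Fin.le_def, Fin.lt_def, hσ z h1 h2]
      omega
  have tx2 : ({j | π y < (Equiv.swap (π x) (π y) * π) j} : Finset (Fin n)) = U := by
    ext z
    rcases hcase z with rfl | rfl | ⟨h1, h2⟩
    · simp only [Finset.mem_filter, Finset.mem_univ, true_and, hσx]
      simp [hU, hlt.le]
    · simp only [Finset.mem_filter, Finset.mem_univ, true_and, hσy]
      simp [hU, hlt.le]
    · simp only [hU, Finset.mem_filter, Finset.mem_univ, true_and, hσ z h1 h2]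
  have ty1 : ({j | π x ≤ (Equiv.swap (π x) (π y) * π) j} : Finset (Fin n)) =
      insert x (insert y U) := by
    rw [← sx1]
    ext z
    rcases hcase z with rfl | rfl | ⟨h1, h2⟩
    · simp only [Finset.mem_filter, Finset.mem_univ, true_and, hσx]
      simp [hlt.le]
    · simp only [Finset.mem_filter, Finset.mem_univ, true_and, hσy]
      simp [hlt.le]
    · simp only [Finset.mem_filter, Finset.mem_univ, true_and, hσ z h1 h2]
  have ty2 : ({j | π x < (Equiv.swap (π x) (π y) * π) j} : Finset (Fin n)) = insert x U := by
    ext z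
    rcases hcase z with rfl | rfl | ⟨h1, h2⟩
    · simp only [Finset.mem_filter, Finset.mem_univ, true_and, hσx]
      simp [hlt]
    · simp only [Finset.mem_filter, Finset.mem_univ, true_and, hσy]
      simp [hU, hxy.symm]
    · have := hval z h1 h2
      simp only [hU, Finset.mem_filter, Finset.mem_univ, true_and, Finset.mem_insert, h1,
        false_or, Fin.lt_def, hσ z h1 h2]
      omega
  -- The edge length is the submodularity defect of `U ∪ {x}` and `U ∪ {y}`, hence nonnegative.
  refine ⟨f (insert x U) + f (insert y U) - f (insert x (insert y U)) - f U, ?_, ?_⟩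
  · have h1 := hf (insert x U) (insert y U)
    have e1 : insert x U ∪ insert y U = insert x (insert y U) := by
      ext z; simp only [Finset.mem_union, Finset.mem_insert]; tauto
    have e2 : insert x U ∩ insert y U = U := by
      ext z
      simp only [Finset.mem_inter, Finset.mem_insert]
      constructor
      · rintro ⟨rfl | h, rfl | h'⟩
        exacts [absurd rfl hxy, h', h, h]
      · exact fun h => ⟨Or.inr h, Or.inr h⟩
    rw [e1, e2] at h1
    linarith
  · ext z
    rcases hcase z with rfl | rfl | ⟨h1, h2⟩
    · simp only [Pi.sub_apply, Pi.smul_apply, smul_eq_mul, greedy, permVertex, hσx]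
      rw [tx1, tx2, sx1, sx2, hkl]
      push_cast
      ring
    · simp only [Pi.sub_apply, Pi.smul_apply, smul_eq_mul, greedy, permVertex, hσy]
      rw [ty1, ty2, sy1, hkl]
      push_cast
      ring
    · simp only [Pi.sub_apply, Pi.smul_apply, smul_eq_mul, greedy, permVertex, hσ z h1 h2,
        sub_self, mul_zero]
      have hz := hval z h1 h2
      have e1 : ({j | π z ≤ (Equiv.swap (π x) (π y) * π) j} : Finset (Fin n)) =
          ({j | π z ≤ π j} : Finset (Fin n)) := by
        ext w
        rcases hcase w with rfl | rfl | ⟨h3, h4⟩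
        · simp only [Finset.mem_filter, Finset.mem_univ, true_and, hσx, Fin.le_def]
          omega
        · simp only [Finset.mem_filter, Finset.mem_univ, true_and, hσy, Fin.le_def]
          omega
        · simp only [Finset.mem_filter, Finset.mem_univ, true_and, hσ w h3 h4]
      have e2 : ({j | π z < (Equiv.swap (π x) (π y) * π) j} : Finset (Fin n)) =
          ({j | π z < π j} : Finset (Fin n)) := by
        ext w
        rcases hcase w with rfl | rfl | ⟨h3, h4⟩
        · simp only [Finset.mem_filter, Finset.mem_univ, true_and, hσx, Fin.lt_def]
          omega
        · simp only [Finset.mem_filter, Finset.mem_univ, true_and, hσy, Fin.lt_def]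
          omega
        · simp only [Finset.mem_filter, Finset.mem_univ, true_and, hσ w h3 h4]
      rw [e1, e2, sub_self]

/-! ### Weights of the flagged Weyl module -/

/-- The inverse is the one from the dual representation; it cancels the inverse in `f(g⁻¹ Y)`, so
dual weights have nonnegative exponents. -/
theorem translate_torus_inv_genericUpper (x : Fin n → ℂˣ) (i j : Fin n) :
    translate (torus x)⁻¹ (genericUpper n i j) =
      MvPolynomial.C (x i : ℂ) * genericUpper n i j := by
  rw [translate_genericUpper, invMulGeneric, inv_inv]
  have e : ((torus x : borel n) : GL (Fin n) ℂ).val.map (MvPolynomial.C : ℂ →+* CoordRing n) =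
      Matrix.diagonal fun i => MvPolynomial.C (x i : ℂ) := by
    change (Matrix.diagonal fun i => (x i : ℂ)).map _ = _
    rw [Matrix.diagonal_map (map_zero _)]
  rw [e, Matrix.diagonal_mul]

theorem translate_torus_inv_minor (x : Fin n → ℂˣ) (R S : Finset (Fin n))
    (h : S.card = R.card) :
    translate (torus x)⁻¹ (minor R S h) = (∏ i ∈ S, (x i : ℂ)) • minor R S h := by
  have e : ∏ i ∈ S, (MvPolynomial.C (x i : ℂ) : CoordRing n) =
      ∏ k : Fin R.card, MvPolynomial.C (x (S.orderEmbOfFin h k) : ℂ) := by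
    conv_lhs => rw [← Finset.map_orderEmbOfFin_univ S h, Finset.prod_map]
    rfl
  rw [MvPolynomial.smul_eq_C_mul, map_prod, e, minor, ← Matrix.det_mul_column, AlgHom.map_det]
  congr 1
  ext1 k l
  simp [translate_torus_inv_genericUpper]

/-- Specialize to 1 the variables pairing the `k`-th elements of `S` and `R`, and all others to 0.
The Gale order puts these pairs on or above the diagonal of `Y`, so the submatrix becomes the
identity. -/
theorem minor_ne_zero {R S : Finset (Fin n)} (h : GaleLE S R) : minor R S h.fst ≠ 0 := by
  classical
  obtain ⟨hc, hle⟩ := h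
  intro h0
  let φ : CoordRing n →ₐ[ℂ] ℂ := MvPolynomial.aeval fun p =>
    if ∃ k, S.orderEmbOfFin hc k = p.1.1 ∧ R.orderEmbOfFin rfl k = p.1.2 then 1 else 0
  have h1 : φ (minor R S hc) = 1 := by
    rw [minor, AlgHom.map_det]
    convert Matrix.det_one (n := Fin R.card) (R := ℂ)
    ext k l
    rw [AlgHom.mapMatrix_apply, Matrix.map_apply, Matrix.submatrix_apply, genericUpper,
      Matrix.of_apply, Matrix.one_apply]
    by_cases hkl : k = l
    · subst hkl
      rw [dif_pos (hle k), if_pos rfl, MvPolynomial.aeval_X, if_pos ⟨k, rfl, rfl⟩]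
    · rw [if_neg hkl]
      split_ifs with h
      · rw [MvPolynomial.aeval_X, if_neg]
        rintro ⟨m, hm1, hm2⟩
        exact hkl (((S.orderEmbOfFin hc).injective hm1).symm.trans
          ((R.orderEmbOfFin rfl).injective hm2))
      · exact map_zero _
  rw [h0, map_zero] at h1
  exact zero_ne_one h1

/-- The tuples `C ≤ D`, which index the spanning set of `M_D`. -/
abbrev Below (D : Fin n → Finset (Fin n)) : Type :=
  {C : Fin n → Finset (Fin n) // ∀ j, GaleLE (C j) (D j)}

/-- The product of minors indexed by `C ≤ D`, as an element of `M_D`. -/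
def minorProd (D : Fin n → Finset (Fin n)) (C : Below D) : (weylSubrep D).toSubmodule :=
  ⟨∏ j, minor (D j) (C.1 j) (C.2 j).fst, Submodule.subset_span ⟨C.1, C.2, rfl⟩⟩

/-- The multiplicity vector `∑_j 1_{C_j}`. -/
def weight (C : Fin n → Finset (Fin n)) : Fin n →₀ ℕ :=
  ∑ j, ∑ i ∈ C j, Finsupp.single i 1

theorem weight_apply (C : Fin n → Finset (Fin n)) (i : Fin n) :
    weight C i = ∑ j, if i ∈ C j then 1 else 0 := by
  simp [weight, Finsupp.finsetSum_apply, Finsupp.single_apply]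

theorem eval_monomial_weight (x : Fin n → ℂ) (C : Fin n → Finset (Fin n)) :
    MvPolynomial.eval x (MvPolynomial.monomial (weight C) 1) = ∏ j, ∏ i ∈ C j, x i := by
  have : (MvPolynomial.monomial (weight C) 1 : MvPolynomial (Fin n) ℂ) =
      ∏ j, ∏ i ∈ C j, MvPolynomial.X i := by
    simp only [weight, MvPolynomial.X, MvPolynomial.monomial_sum_one]
  rw [this]
  simp

theorem span_range_minorProd (D : Fin n → Finset (Fin n)) :
    Submodule.span ℂ (Set.range (minorProd D)) = ⊤ := by
  apply Submodule.map_injective_of_injective (weylSubrep D).toSubmodule.injective_subtype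
  rw [Submodule.map_span, Submodule.map_top, Submodule.range_subtype, ← Set.range_comp]
  change _ = weylSubmodule D
  rw [weylSubmodule]
  congr 1
  ext f
  constructor
  · rintro ⟨C, rfl⟩
    exact ⟨C.1, C.2, rfl⟩
  · rintro ⟨C, h, rfl⟩
    exact ⟨⟨C, h⟩, rfl⟩

theorem minorProd_ne_zero (D : Fin n → Finset (Fin n)) (C : Below D) : minorProd D C ≠ 0 := by
  intro h
  have h' : ∏ j, minor (D j) (C.1 j) (C.2 j).fst = 0 := congrArg Subtype.val h
  exact Finset.prod_ne_zero_iff.2 (fun j _ => minor_ne_zero (C.2 j)) h'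

theorem weylModule_torus_inv_minorProd (D : Fin n → Finset (Fin n)) (x : Fin n → ℂˣ)
    (C : Below D) :
    weylModule D (torus x)⁻¹ (minorProd D C) =
      (MvPolynomial.eval (fun i => (x i : ℂ)) (MvPolynomial.monomial (weight C.1) 1)) •
        minorProd D C := by
  apply Subtype.ext
  change translate (torus x)⁻¹ (∏ j, minor (D j) (C.1 j) (C.2 j).fst) =
    _ • ∏ j, minor (D j) (C.1 j) (C.2 j).fst
  rw [map_prod, eval_monomial_weight]
  simp only [translate_torus_inv_minor]
  rw [Finset.prod_smul]

theorem eq_of_forall_eval_units {p q : MvPolynomial (Fin n) ℂ}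
    (h : ∀ x : Fin n → ℂˣ, MvPolynomial.eval (fun i => (x i : ℂ)) p =
      MvPolynomial.eval (fun i => (x i : ℂ)) q) : p = q := by
  refine MvPolynomial.funext_set (fun _ => {z : ℂ | z ≠ 0})
    (fun _ => (Set.finite_singleton (0 : ℂ)).infinite_compl) fun x hx => ?_
  exact h fun i => Units.mk0 (x i) (hx i (Set.mem_univ i))

/-- The dual action of `g` is the transpose of the action of `g⁻¹`, and the trace ignores
transposition; on a basis of eigenvectors it is the sum of the eigenvalues. -/
theorem dualCharacter_weylModule_eq {κ : Type*} [Fintype κ] {D : Fin n → Finset (Fin n)}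
    (b : Module.Basis κ ℂ (weylSubrep D).toSubmodule) (a : κ → Below D)
    (hb : ∀ k, b k = minorProd D (a k)) (x : Fin n → ℂˣ) :
    dualCharacter (weylModule D) x = MvPolynomial.eval (fun i => (x i : ℂ))
      (∑ k, MvPolynomial.monomial (weight (a k).1) 1) := by
  classical
  have : Module.Finite ℂ (weylSubrep D).toSubmodule := .of_basis b
  rw [dualCharacter, character, Representation.dual_apply, LinearMap.trace_transpose',
    LinearMap.trace_eq_matrix_trace ℂ b, Matrix.trace, map_sum]
  refine Finset.sum_congr rfl fun k _ => ?_
  rw [Matrix.diag_apply, LinearMap.toMatrix_apply, hb, weylModule_torus_inv_minorProd, ← hb]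
  simp

/-- A nonzero eigenvector has some nonzero coordinate `k`. Comparing that coordinate before and
after the torus acts equates the two eigenvalues for all `x`, hence the two monomials. -/
theorem exists_weight_eq_of_basis {κ : Type*} [Fintype κ] {D : Fin n → Finset (Fin n)}
    (b : Module.Basis κ ℂ (weylSubrep D).toSubmodule) (a : κ → Below D)
    (hb : ∀ k, b k = minorProd D (a k)) (C : Below D) :
    ∃ k, weight (a k).1 = weight C.1 := by
  classical
  obtain ⟨k, hk⟩ : ∃ k, b.repr (minorProd D C) k ≠ 0 := by
    by_contra! h
    exact minorProd_ne_zero D C (b.repr.map_eq_zero_iff.1 (Finsupp.ext h))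
  refine ⟨k, ?_⟩
  have key : (MvPolynomial.monomial (weight (a k).1) 1 : MvPolynomial (Fin n) ℂ) =
      MvPolynomial.monomial (weight C.1) 1 := by
    refine eq_of_forall_eval_units fun x => ?_
    have h1 := congrArg (fun v => b.repr v k) (weylModule_torus_inv_minorProd D x C)
    have h2 : b.repr (weylModule D (torus x)⁻¹ (minorProd D C)) k =
        MvPolynomial.eval (fun i => (x i : ℂ)) (MvPolynomial.monomial (weight (a k).1) 1) *
          b.repr (minorProd D C) k := by
      conv_lhs => rw [← b.sum_repr (minorProd D C)]
      simp only [map_sum, map_smul, hb, weylModule_torus_inv_minorProd]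
      simp only [← hb, Finsupp.finsetSum_apply, Finsupp.smul_apply,
        Module.Basis.repr_self, Finsupp.single_apply, smul_eq_mul]
      simp [mul_comm]
    simp only [h2, map_smul, Finsupp.smul_apply, smul_eq_mul] at h1
    exact mul_right_cancel₀ hk h1
  exact MvPolynomial.monomial_left_injective one_ne_zero key

theorem exists_character_polynomial (D : Fin n → Finset (Fin n)) :
    ∃ χ : MvPolynomial (Fin n) ℂ, IsDualCharacter D χ ∧
      (∀ m ∈ χ.support, ∃ c : ℕ, 0 < c ∧ χ.coeff m = (c : ℂ)) ∧
      ∀ m, m ∈ χ.support ↔ ∃ C : Fin n → Finset (Fin n),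
        (∀ j, GaleLE (C j) (D j)) ∧ weight C = m := by
  classical
  obtain ⟨κ, a, ha, hspan, hli⟩ := exists_linearIndependent' ℂ (minorProd D)
  have : Finite κ := Finite.of_injective a ha
  have := Fintype.ofFinite κ
  rw [span_range_minorProd] at hspan
  let b := Module.Basis.mk hli hspan.ge
  have hb : ∀ k, b k = minorProd D (a k) := fun k => by simp [b]
  -- Each coefficient counts basis vectors of a given weight; in characteristic zero it vanishes
  -- only if there are none.
  have hcoeff : ∀ m, (∑ k, MvPolynomial.monomial (weight (a k).1) (1 : ℂ)).coeff m =
      ((Finset.univ.filter fun k => weight (a k).1 = m).card : ℂ) := by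
    intro m
    simp [MvPolynomial.coeff_sum, MvPolynomial.coeff_monomial]
  refine ⟨∑ k, MvPolynomial.monomial (weight (a k).1) 1,
    fun x => (dualCharacter_weylModule_eq b a hb x).symm, fun m hm => ?_, fun m => ?_⟩
  · refine ⟨_, Nat.pos_of_ne_zero fun h => ?_, hcoeff m⟩
    rw [MvPolynomial.mem_support_iff, hcoeff, h] at hm
    exact hm Nat.cast_zero
  · rw [MvPolynomial.mem_support_iff, hcoeff, Nat.cast_ne_zero, ← Nat.pos_iff_ne_zero,
      Finset.card_pos]
    constructor
    · rintro ⟨k, hk⟩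
      exact ⟨(a k).1, (a k).2, (Finset.mem_filter.1 hk).2⟩
    · rintro ⟨C, hC, rfl⟩
      obtain ⟨k, hk⟩ := exists_weight_eq_of_basis b a hb ⟨C, hC⟩
      exact ⟨k, Finset.mem_filter.2 ⟨Finset.mem_univ k, hk⟩⟩

/-! ### Matroid polytopes -/

/-- The rank function of a matroid on `[n]`, with integer values. -/
def rank (M : Matroid (Fin n)) (I : Finset (Fin n)) : ℤ := (M.eRk I).toNat

theorem coe_toNat_eRk (M : Matroid (Fin n)) (X : Set (Fin n)) :
    ((M.eRk X).toNat : ℕ∞) = M.eRk X :=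
  ENat.natCast_toNat (ne_top_of_le_ne_top (Set.encard_ne_top_iff.2 X.toFinite) (M.eRk_le_encard X))

theorem rank_empty (M : Matroid (Fin n)) : rank M ∅ = 0 := by simp [rank]

theorem isSubmodular_rank (M : Matroid (Fin n)) : IsSubmodular (rank M) := by
  intro I J
  have h := M.eRk_inter_add_eRk_union_le (I : Set (Fin n)) J
  simp only [rank, Finset.coe_union, Finset.coe_inter]
  rw [← coe_toNat_eRk, ← coe_toNat_eRk M (_ ∪ _), ← coe_toNat_eRk M I,
    ← coe_toNat_eRk M J] at h
  norm_cast at h ⊢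
  omega

theorem rank_mono (M : Matroid (Fin n)) {I J : Finset (Fin n)} (h : I ⊆ J) :
    rank M I ≤ rank M J := by
  have := M.eRk_mono (Finset.coe_subset.2 h)
  rw [← coe_toNat_eRk, ← coe_toNat_eRk M J] at this
  simp only [rank]
  exact_mod_cast this

theorem rank_le_card (M : Matroid (Fin n)) (I : Finset (Fin n)) : rank M I ≤ I.card := by
  have := M.eRk_le_encard I
  rw [← coe_toNat_eRk, Set.encard_coe_eq_coe_finsetCard] at this
  simp only [rank]
  exact_mod_cast this

theorem matroidPolytope_eq_basePolytope (M : Matroid (Fin n)) :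
    matroidPolytope M = basePolytope fun I => (rank M I : ℝ) := by
  ext t
  simp only [matroidPolytope, basePolytope, rank, Set.mem_ofPred_eq, Finset.coe_univ,
    Int.cast_natCast]
  refine ⟨fun ⟨h, h'⟩ => ⟨fun I => ?_, h'⟩, fun ⟨h, h'⟩ => ⟨fun I _ => h I, h'⟩⟩
  by_cases hI : I = Finset.univ
  · rw [hI, h', Finset.coe_univ]
  · exact h I hI

/-- The integer points of a matroid polytope are the indicator vectors of bases. -/
theorem exists_isBase_of_forall_sum_le_rank (M : Matroid (Fin n))
    (p : Fin n → ℤ) (hp : ∀ I, ∑ i ∈ I, p i ≤ rank M I)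
    (hp' : ∑ i, p i = rank M Finset.univ) :
    ∃ B : Finset (Fin n), M.IsBase B ∧ p = fun i => if i ∈ B then 1 else 0 := by
  have h1 : ∀ i, p i ≤ 1 := fun i => by
    have := (hp {i}).trans (rank_le_card M {i})
    simpa using this
  -- The coordinate is the total minus the sum over the complement of `i`, hence at least `r([n]) -
  -- r([n] \ {i}) ≥ 0`.
  have h0 : ∀ i, 0 ≤ p i := fun i => by
    have h2 := (hp (Finset.univ.erase i)).trans (rank_mono M (Finset.subset_univ _))
    have h3 := Finset.add_sum_erase Finset.univ p (Finset.mem_univ i)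
    lia
  have hpe : p = fun i => if i ∈ (Finset.univ.filter fun i => p i = 1) then 1 else 0 := by
    ext i
    have := h0 i
    have := h1 i
    simp only [Finset.mem_filter, Finset.mem_univ, true_and]
    split_ifs <;> lia
  refine ⟨_, ?_, hpe⟩
  set B : Finset (Fin n) := Finset.univ.filter fun i => p i = 1 with hB
  have hBsum : ∑ i ∈ B, p i = B.card := by
    rw [Finset.sum_congr rfl fun i hi => (Finset.mem_filter.1 hi).2, Finset.sum_const,
      nsmul_one]
  have huniv : ∑ i, p i = B.card := by
    calc ∑ i, p i = ∑ i, if i ∈ B then 1 else 0 := Finset.sum_congr rfl fun i _ => congrFun hpe i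
      _ = B.card := by rw [Finset.sum_boole, Finset.filter_univ_mem]
  -- The chain `|B| = p(B) ≤ r(B) ≤ |B|` forces equality; since also `|B| = p([n]) = r([n])`, the
  -- set is a base.
  have hind : M.Indep (B : Set (Fin n)) := by
    rw [Matroid.indep_iff_eRk_eq_encard_of_finite B.finite_toSet,
      Set.encard_coe_eq_coe_finsetCard, ← coe_toNat_eRk]
    have h2 := hp B
    have h3 := rank_le_card M B
    rw [hBsum] at h2
    simp only [rank] at h2 h3
    norm_cast at h2 h3 ⊢
    exact le_antisymm h3 h2
  refine hind.isBase_of_eRk_ge B.finite_toSet ?_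
  rw [hind.eRk_eq_encard, Set.encard_coe_eq_coe_finsetCard, ← M.eRk_univ_eq, ← coe_toNat_eRk]
  rw [huniv, rank, Finset.coe_univ] at hp'
  norm_cast at hp' ⊢
  exact hp'.ge

theorem indicator_mem_basePolytope (M : Matroid (Fin n)) {B : Finset (Fin n)}
    (hB : M.IsBase (B : Set (Fin n))) :
    (fun i => if i ∈ B then (1 : ℝ) else 0) ∈ basePolytope fun I => (rank M I : ℝ) := by
  have hsum : ∀ I : Finset (Fin n),
      ∑ i ∈ I, (if i ∈ B then (1 : ℝ) else 0) = ((I ∩ B).card : ℝ) := fun I => by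
    simp
  refine ⟨fun I => ?_, ?_⟩
  · rw [hsum]
    have h1 := (hB.indep.subset (by simp : ((I ∩ B : Finset (Fin n)) : Set (Fin n)) ⊆ B)
      ).eRk_eq_encard
    have h2 := M.eRk_mono (Finset.coe_subset.2 (Finset.inter_subset_left : I ∩ B ⊆ I))
    rw [h1, Set.encard_coe_eq_coe_finsetCard, ← coe_toNat_eRk] at h2
    simp only [rank, Int.cast_natCast]
    exact_mod_cast h2
  · rw [hsum, Finset.univ_inter]
    have h1 := hB.encard_eq_eRank
    rw [Set.encard_coe_eq_coe_finsetCard, ← M.eRk_univ_eq, ← coe_toNat_eRk] at h1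
    simp only [rank, Int.cast_natCast, Finset.coe_univ]
    exact_mod_cast h1

theorem isSubmodular_intCast {f : Finset (Fin n) → ℤ} (hf : IsSubmodular f) :
    IsSubmodular fun I => (f I : ℝ) := fun I J => by
  dsimp only
  exact_mod_cast hf I J

/-- Greedy vertices are differences of ranks, hence integer points of the polytope, hence indicators
of bases. -/
theorem basePolytope_rank_eq_convexHull (M : Matroid (Fin n)) :
    basePolytope (fun I => (rank M I : ℝ)) = convexHull ℝ
      {t | ∃ B : Finset (Fin n), M.IsBase B ∧ t = fun i => if i ∈ B then (1 : ℝ) else 0} := by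
  have hsub := isSubmodular_intCast (isSubmodular_rank M)
  have h0 : (rank M ∅ : ℝ) = 0 := by rw [rank_empty, Int.cast_zero]
  apply Set.Subset.antisymm
  · rw [basePolytope_eq_convexHull hsub h0]
    refine convexHull_mono ?_
    rintro _ ⟨π, rfl⟩
    have hg := greedy_mem_basePolytope hsub h0 π
    have hcast : greedy (fun I => (rank M I : ℝ)) π =
        fun i => ((rank M {j | π i ≤ π j} - rank M {j | π i < π j} : ℤ) : ℝ) := by
      ext i
      simp [greedy]
    rw [hcast] at hg ⊢
    obtain ⟨hg1, hg2⟩ := hg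
    dsimp only at hg1 hg2
    obtain ⟨B, hB, hpB⟩ := exists_isBase_of_forall_sum_le_rank M
      (fun i => rank M {j | π i ≤ π j} - rank M {j | π i < π j})
      (fun I => by exact_mod_cast hg1 I) (by exact_mod_cast hg2)
    refine ⟨B, hB, ?_⟩
    ext i
    rw [congrFun hpB i]
    split_ifs <;> simp
  · refine convexHull_min ?_ (convex_basePolytope _)
    rintro _ ⟨B, hB, rfl⟩
    exact indicator_mem_basePolytope M hB

theorem schubertMatroid_isBase_iff (S R : Finset (Fin n)) :
    (schubertMatroid S).IsBase (R : Set (Fin n)) ↔ GaleLE R S := by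
  change (∃ R' : Finset (Fin n), (R' : Set (Fin n)) = R ∧ GaleLE R' S) ↔ _
  simp

end FlaggedWeyl

end

open FlaggedWeyl

theorem mainTheorem1 (n : ℕ) (D : Fin n → Finset (Fin n)) :
    ∃ χ : MvPolynomial (Fin n) ℂ,
      (∀ ψ : MvPolynomial (Fin n) ℂ, FlaggedWeyl.IsDualCharacter D ψ ↔ ψ = χ) ∧
      FlaggedWeyl.HasSNP χ ∧
      (∀ m ∈ χ.support, ∃ c : ℕ, 0 < c ∧ χ.coeff m = (c : ℂ)) ∧
      FlaggedWeyl.newtonPolytope χ =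
        ∑ j : Fin n, FlaggedWeyl.matroidPolytope (FlaggedWeyl.schubertMatroid (D j)) ∧
      FlaggedWeyl.IsGeneralizedPermutahedron (FlaggedWeyl.newtonPolytope χ) := by
  obtain ⟨χ, hχ, hpos, hsupp⟩ := exists_character_polynomial D
  have hsub : ∀ j, IsSubmodular fun I => (rank (schubertMatroid (D j)) I : ℝ) := fun j =>
    isSubmodular_intCast (isSubmodular_rank _)
  have h0 : ∀ j, (rank (schubertMatroid (D j)) ∅ : ℝ) = 0 := fun j => by
    rw [rank_empty, Int.cast_zero]
  -- The independent choices of `C_j ≤ D_j` are independent choices of bases, so the support is a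
  -- Minkowski sum even before convex hulls are taken.
  have hpoints : supportPoints χ = ∑ j, {t | ∃ B : Finset (Fin n),
      (schubertMatroid (D j)).IsBase B ∧ t = fun i => if i ∈ B then (1 : ℝ) else 0} := by
    ext t
    rw [Set.mem_fintype_sum]
    constructor
    · rintro ⟨m, hm, rfl⟩
      obtain ⟨C, hC, rfl⟩ := (hsupp m).1 hm
      refine ⟨fun j i => if i ∈ C j then 1 else 0, fun j =>
        ⟨C j, (schubertMatroid_isBase_iff _ _).2 (hC j), rfl⟩, ?_⟩
      ext i
      simp [weight_apply, Finset.sum_apply]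
    · rintro ⟨g, hg, rfl⟩
      choose C hC hgC using hg
      refine ⟨weight C, (hsupp _).2 ⟨C, fun j =>
        (schubertMatroid_isBase_iff _ _).1 (hC j), rfl⟩, ?_⟩
      ext i
      simp [weight_apply, Finset.sum_apply, hgC]
  have hnewton : newtonPolytope χ =
      basePolytope (∑ j, fun I => (rank (schubertMatroid (D j)) I : ℝ)) := by
    rw [newtonPolytope, hpoints, convexHull_sum, basePolytope_sum _ hsub h0]
    exact Finset.sum_congr rfl fun j _ =>
      (basePolytope_rank_eq_convexHull _).symm
  refine ⟨χ, fun ψ => ⟨fun hψ => eq_of_forall_eval_units fun x => (hψ x).trans (hχ x).symm,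
    fun h => h ▸ hχ⟩, fun p hp => ?_, hpos, ?_, ?_⟩
  · rw [hnewton] at hp
    obtain ⟨hp1, hp2⟩ := hp
    simp only [Finset.sum_apply] at hp1 hp2
    -- SNP: the lattice point splits into integer points of the individual matroid polytopes. Each
    -- is the indicator of a base, so their sum lies in the support.
    obtain ⟨q, hq, rfl⟩ := exists_sum_eq_of_forall_sum_le
      (fun j => rank (schubertMatroid (D j))) (fun j => isSubmodular_rank _)
      (fun j => rank_empty _) Finset.univ p (fun I => by exact_mod_cast hp1 I)
      (by exact_mod_cast hp2)
    rw [hpoints, Set.mem_fintype_sum]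
    refine ⟨fun j i => (q j i : ℝ), fun j => ?_, ?_⟩
    · obtain ⟨B, hB, hqB⟩ := exists_isBase_of_forall_sum_le_rank _
        (q j) (hq j (Finset.mem_univ j)).1 (hq j (Finset.mem_univ j)).2
      refine ⟨B, hB, ?_⟩
      ext i
      simp only [hqB]
      split_ifs <;> simp
    · ext i
      simp [Finset.sum_apply]
  · rw [hnewton, basePolytope_sum _ hsub h0]
    exact Finset.sum_congr rfl fun j _ => (matroidPolytope_eq_basePolytope _).symm
  · rw [hnewton]
    exact isGeneralizedPermutahedron_basePolytope (isSubmodular_sum _ hsub)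
      (by simp [Finset.sum_apply, h0])
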